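/- Let $n\ge 2$ be an integer and let $\phi\in L^1(\mathbb R)\cap L^2(\mathbb R)$ be complex-valued. Put $$V_2(\phi)=\Big\{\sum_{k\in\mathbb Z}c(k)\,\phi(\cdot-k)\ :\ c\in\ell^2(\mathbb Z)\Big\},$$ the series converging in $L^2(\mathbb R)$. Suppose that the integer translates of $\phi$ form a Riesz basis of $V_2(\phi)$, i.e. there are constants $A,B>0$ such that for every $c\in\ell^2(\mathbb Z)$ the series $\sum_{k}c(k)\phi(\cdot-k)$ converges in $L^2(\mathbb R)$ and $$A\|c\|_{\ell^2}\le\Big\|\sum_{k\in\mathbb Z}c(k)\phi(\cdot-k)\Big\|_{L^2}\le B\|c\|_{\ell^2}.$$ Suppose further that $V_2(\phi)$ is $\frac1n\mathbb Z$-invariant, i.e. $f(\cdot-t)\in V_2(\phi)$ for all $f\in V_2(\phi)$ and all $t\in\frac1n\mathbb Z$. Let $\widehat\phi(\xi)=\int_{\mathbb R}\phi(x)e^{-2\pi i x\xi}\,dx$. Then for every $\epsilon>0$, $$\sup_{\xi\in\mathbb R}|\widehat\phi(\xi)|\,|\xi|^{1/2+\epsilon}=+\infty .$$ -/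

import Mathlib

open MeasureTheory
open scoped FourierTransform

namespace ShiftInvariant

/-- The space `L²(ℝ)` of (classes of) complex-valued square-integrable functions. -/
abbrev L2 : Type := Lp ℂ 2 (volume : Measure ℝ)

/-- The space `ℓ²(ℤ)` of square-summable complex sequences. -/
abbrev ell2 : Type := lp (fun _ : ℤ => ℂ) 2

/-- The translate `f(· - t)` of `f ∈ L²(ℝ)`. -/
noncomputable def l2Translate (t : ℝ) (f : L2) : L2 :=
  Lp.compMeasurePreserving (fun x : ℝ => x - t) (measurePreserving_sub_right volume t) f

theorem l2Translate_ae_eq (t : ℝ) (f : L2) :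
    l2Translate t f =ᵐ[volume] fun x : ℝ => f (x - t) :=
  Lp.coeFn_compMeasurePreserving f (measurePreserving_sub_right volume t)

/-- `V₂(φ)`: all sums in `L²(ℝ)` of the series `∑ₖ c(k) φ(· - k)` with `c ∈ ℓ²(ℤ)`. -/
def V2 (φ : L2) : Set L2 :=
  {f | ∃ c : ell2, HasSum (fun k : ℤ => c k • l2Translate (k : ℝ) φ) f}

/-- The integer translates of `φ` form a Riesz basis of `V₂(φ)`: there are constants `A, B > 0`
such that, for every `c ∈ ℓ²(ℤ)`, the series `∑ₖ c(k) φ(· - k)` converges in `L²(ℝ)` and its sum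
has norm between `A ‖c‖` and `B ‖c‖`. -/
def IsRieszGenerator (φ : L2) : Prop :=
  ∃ A B : ℝ, 0 < A ∧ 0 < B ∧ ∀ c : ell2, ∃ f : L2,
    HasSum (fun k : ℤ => c k • l2Translate (k : ℝ) φ) f ∧ A * ‖c‖ ≤ ‖f‖ ∧ ‖f‖ ≤ B * ‖c‖

/-- The set `τ(V)` of all `t ∈ ℝ` such that `f(· - t) ∈ V` for all `f ∈ V`. -/
def tau (V : Set L2) : Set ℝ :=
  {t | ∀ f ∈ V, l2Translate t f ∈ V}

/-- `V` is `(1/n)ℤ`-invariant: every element of `(1/n)ℤ` lies in `τ(V)`. -/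
def IsInvInvariant (n : ℕ) (V : Set L2) : Prop :=
  ∀ m : ℤ, (m : ℝ) / (n : ℝ) ∈ tau V

end ShiftInvariant

namespace ShiftInvariant

/-! Assume `|φ̂(ξ)| |ξ|^(1/2+ε)` is bounded. Two facts collide. Invariance: on the Fourier side `φ(·
- 1/n)` is a 1-periodic multiplier times `φ̂`, yet also `e^{-2πiξ/n} φ̂`. Comparing `ξ` with `ξ + j`
gives `φ̂(ξ) φ̂(ξ + j) = 0` unless `n ∣ j` (`fourier_mul_fourier_eq_zero`). Riesz bound: the decay
makes the periodization of `|φ̂|²` continuous, and the lower bound keeps it from vanishing at any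
point (`exists_fourier_add_int_ne_zero`). So each `ξ` determines one residue class mod `n`
containing all `j` with `φ̂(ξ + j) ≠ 0`. By continuity of `φ̂` this class is locally constant, hence
constant on `ℝ`; but replacing `ξ` by `ξ + 1` lowers it by 1, impossible for `n ≥ 2`. -/

/-! ### Fourier transform on `L¹ ∩ L²` -/

theorem continuous_fourier_of_memLp {f : ℝ → ℂ} (h1 : MemLp f 1 (volume : Measure ℝ)) :
    Continuous (𝓕 f) :=
  VectorFourier.fourierIntegral_continuous Real.continuous_fourierChar
    (innerSL ℝ).continuous₂ (memLp_one_iff_integrable.1 h1)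

theorem norm_fourier_le_integral_norm (f : ℝ → ℂ) (ξ : ℝ) :
    ‖𝓕 f ξ‖ ≤ ∫ x, ‖f x‖ :=
  VectorFourier.norm_fourierIntegral_le_integral_norm _ _ _ _ _

/-- The Fourier transform on `L²` is given by the Fourier integral on `L¹ ∩ L²`. -/
theorem coeFn_fourier_toLp {f : ℝ → ℂ} (h1 : MemLp f 1 (volume : Measure ℝ))
    (h2 : MemLp f 2 (volume : Measure ℝ)) :
    (𝓕 (h2.toLp f) : L2) =ᵐ[volume] 𝓕 f := by
  refine ae_eq_of_integral_contDiff_smul_eq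
    ((Lp.memLp (𝓕 (h2.toLp f) : L2)).locallyIntegrable (by norm_num))
    (continuous_fourier_of_memLp h1).locallyIntegrable fun g hg hgc => ?_
  have hc : HasCompactSupport (Complex.ofRealCLM ∘ g) := hgc.comp_left rfl
  have hs : ContDiff ℝ (⊤ : ℕ∞) (Complex.ofRealCLM ∘ g) := by fun_prop
  set u := hc.toSchwartzMap hs with hu
  have hug : ∀ x, u x = (g x : ℂ) := fun x => by simp [hu]
  -- The `L²` transform is moved onto the test function distributionally, then Fubini moves it back
  -- onto `f` as an integral.
  have key := congrArg (fun T => T u)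
    (MeasureTheory.Lp.fourier_toTemperedDistribution_eq (h2.toLp f))
  simp only [TemperedDistribution.fourier_apply, Lp.toTemperedDistribution_apply] at key
  have hflip : ∫ ξ, 𝓕 (u : ℝ → ℂ) ξ • f ξ = ∫ x, u x • 𝓕 f x := by
    simpa using! VectorFourier.integral_bilin_fourierIntegral_eq_flip
      (ContinuousLinearMap.lsmul ℂ ℂ : ℂ →L[ℂ] ℂ →L[ℂ] ℂ) (L := innerₗ ℝ)
      Real.continuous_fourierChar continuous_inner u.integrable (memLp_one_iff_integrable.1 h1)
  calc ∫ x, g x • (𝓕 (h2.toLp f) : L2) x = ∫ x, u x • (𝓕 (h2.toLp f) : L2) x := by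
        simp [hug]
    _ = ∫ x, (𝓕 u) x • (h2.toLp f) x := key.symm
    _ = ∫ ξ, 𝓕 (u : ℝ → ℂ) ξ • f ξ := by
        refine integral_congr_ae ?_
        filter_upwards [h2.coeFn_toLp] with x hx
        rw [hx, SchwartzMap.fourier_coe]
    _ = ∫ x, g x • 𝓕 f x := by rw [hflip]; simp [hug]

theorem fourier_translate (f : ℝ → ℂ) (t ξ : ℝ) :
    𝓕 (fun x => f (x - t)) ξ = (𝐞 (-(t * ξ)) : ℂ) * 𝓕 f ξ := by
  have h := congrFun (VectorFourier.fourierIntegral_comp_add_right 𝐞 (volume : Measure ℝ)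
    (innerₗ ℝ) f (-t)) ξ
  have hi : innerₗ ℝ (-t) ξ = -(t * ξ) := by simp [mul_comm]
  simp only [hi, Circle.smul_def, smul_eq_mul] at h
  exact h

/-- Translation becomes modulation under the Fourier transform. -/
theorem coeFn_fourier_l2Translate {f : ℝ → ℂ} (h1 : MemLp f 1 (volume : Measure ℝ))
    (h2 : MemLp f 2 (volume : Measure ℝ)) (t : ℝ) :
    (𝓕 (l2Translate t (h2.toLp f)) : L2) =ᵐ[volume] fun ξ => (𝐞 (-(t * ξ)) : ℂ) * 𝓕 f ξ := by
  have mp := measurePreserving_sub_right (volume : Measure ℝ) t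
  have h : l2Translate t (h2.toLp f) = (h2.comp_measurePreserving mp).toLp _ :=
    Lp.toLp_compMeasurePreserving h2 mp
  rw [h]
  refine (coeFn_fourier_toLp (h1.comp_measurePreserving mp) _).trans (.of_forall fun ξ => ?_)
  exact fourier_translate f t ξ

/-! ### Consequence of invariance on cosets of `ℤ` -/

/-- Multiplication by a bounded function on `L²`. -/
noncomputable def mulL2 (m : Lp ℂ ⊤ (volume : Measure ℝ)) : L2 →L[ℂ] L2 :=
  (ContinuousLinearMap.mul ℂ ℂ).holderL volume ⊤ 2 2 m

theorem coeFn_mulL2 (m : Lp ℂ ⊤ (volume : Measure ℝ)) (h : L2) :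
    mulL2 m h =ᵐ[volume] fun x => m x * h x :=
  ContinuousLinearMap.coeFn_holder (ContinuousLinearMap.mul ℂ ℂ) m h

/-- Translation as a linear map on `L²`. -/
noncomputable def translateCLM (t : ℝ) : L2 →L[ℂ] L2 :=
  (Lp.compMeasurePreservingₗᵢ ℂ (fun x : ℝ => x - t)
    (measurePreserving_sub_right volume t)).toContinuousLinearMap

theorem coeFn_translateCLM (t : ℝ) (h : L2) :
    translateCLM t h =ᵐ[volume] fun x => h (x - t) :=
  l2Translate_ae_eq t h

theorem fourierChar_neg_intCast_mul_add (k : ℤ) (ξ : ℝ) (j : ℤ) :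
    𝐞 (-((k : ℝ) * (ξ + j))) = 𝐞 (-((k : ℝ) * ξ)) := by
  have h : -((k : ℝ) * (ξ + j)) = -((k : ℝ) * ξ) + ((-(k * j) : ℤ) : ℝ) := by push_cast; ring
  rw [h, AddChar.map_add_eq_mul]
  have : 𝐞 ((-(k * j) : ℤ) : ℝ) = 1 := by
    ext
    rw [Real.fourierChar_apply, Circle.coe_one, Complex.exp_eq_one_iff]
    exact ⟨-(k * j), by push_cast; ring⟩
  rw [this, mul_one]

/-- If a translate of `φ` by `t` is a series of integer translates of `φ`, then two values of
`𝓕 φ` at points with integer difference `j` can only be nonzero when `t * j` is an integer. -/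
theorem fourier_mul_fourier_eq_zero {φ : ℝ → ℂ} (h1 : MemLp φ 1 (volume : Measure ℝ))
    (h2 : MemLp φ 2 (volume : Measure ℝ)) {t : ℝ}
    (ht : l2Translate t (h2.toLp φ) ∈ V2 (h2.toLp φ)) {j : ℤ}
    (hj : 𝐞 (-(t * j)) ≠ 1) (ξ : ℝ) :
    𝓕 φ ξ * 𝓕 φ (ξ + j) = 0 := by
  obtain ⟨c, hc⟩ := ht
  set F := 𝓕 φ with hF
  have hFc : Continuous F := continuous_fourier_of_memLp h1
  have hFb : ∀ ξ, ‖F ξ‖ ≤ ∫ x, ‖φ x‖ := norm_fourier_le_integral_norm φ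
  have m1 : MemLp F ⊤ (volume : Measure ℝ) :=
    memLp_top_of_bound hFc.aestronglyMeasurable _ (.of_forall hFb)
  have m2 : MemLp (fun ξ => F (ξ + j)) ⊤ (volume : Measure ℝ) :=
    memLp_top_of_bound (by fun_prop : Continuous fun ξ => F (ξ + j)).aestronglyMeasurable _
      (.of_forall fun ξ => hFb _)
  -- The periodic multiplier is never constructed: `P` and `Q` encode `F(ξ + j) h(ξ)` and `F(ξ) h(ξ
  -- + j)`. They agree on the transforms of integer translates, hence by boundedness on any `L²` sum
  -- of the series.
  set P : L2 →L[ℂ] L2 := mulL2 (m2.toLp _) with hP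
  set Q : L2 →L[ℂ] L2 := mulL2 (m1.toLp _) ∘L translateCLM (-(j : ℝ)) with hQ
  have hPv : ∀ (h : L2) (e : ℝ → ℂ), h =ᵐ[volume] (fun ξ => e ξ * F ξ) →
      P h =ᵐ[volume] fun ξ => F (ξ + j) * (e ξ * F ξ) := by
    intro h e he
    filter_upwards [coeFn_mulL2 (m2.toLp _) h, m2.coeFn_toLp, he] with x a b c
    rw [hP, a, b, c]
  have hQv : ∀ (h : L2) (e : ℝ → ℂ), h =ᵐ[volume] (fun ξ => e ξ * F ξ) →
      Q h =ᵐ[volume] fun ξ => F ξ * (e (ξ + j) * F (ξ + j)) := by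
    intro h e he
    have he' := (measurePreserving_add_right (volume : Measure ℝ) (j : ℝ)).quasiMeasurePreserving.ae
      he
    filter_upwards [coeFn_mulL2 (m1.toLp _) (translateCLM (-(j : ℝ)) h), m1.coeFn_toLp,
      coeFn_translateCLM (-(j : ℝ)) h, he'] with x a b c d
    rw [hQ, ContinuousLinearMap.comp_apply, a, b, c, sub_neg_eq_add, d]
  have hk : ∀ k : ℤ, P (𝓕 (l2Translate (k : ℝ) (h2.toLp φ)) : L2)
      = Q (𝓕 (l2Translate (k : ℝ) (h2.toLp φ)) : L2) := by
    intro k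
    have h := coeFn_fourier_l2Translate h1 h2 (k : ℝ)
    refine Lp.ext ((hPv _ _ h).trans (.trans (.of_forall fun ξ => ?_) (hQv _ _ h).symm))
    simp only [fourierChar_neg_intCast_mul_add]
    ring
  have hs := hc.mapL (Lp.fourierTransformₗᵢ ℝ ℂ).toContinuousLinearEquiv.toContinuousLinearMap
  have hPQ : P (𝓕 (l2Translate t (h2.toLp φ)) : L2) = Q (𝓕 (l2Translate t (h2.toLp φ)) : L2) := by
    refine (hs.mapL P).unique ?_
    convert hs.mapL Q using 2 with k
    · rw [map_smul, map_smul, map_smul]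
      exact congrArg _ (hk k)
    · rfl
  have ht := coeFn_fourier_l2Translate h1 h2 t
  have hae : (fun ξ => F ξ * F (ξ + j)) =ᵐ[volume] fun _ => 0 := by
    filter_upwards [hPv _ _ ht, hQv _ _ ht] with x a b
    rw [hPQ, b] at a
    have hx : (𝐞 (-(t * (x + j))) : ℂ) = 𝐞 (-(t * x)) * 𝐞 (-(t * j)) := by
      rw [← Circle.coe_mul, ← AddChar.map_add_eq_mul]; congr 2; ring
    rw [hx] at a
    have hne : (𝐞 (-(t * j)) : ℂ) - 1 ≠ 0 := by
      rw [sub_ne_zero]; exact fun h => hj (Circle.ext h)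
    have : ((𝐞 (-(t * j)) : ℂ) - 1) * ((𝐞 (-(t * x)) : ℂ) * (F x * F (x + j))) = 0 := by
      linear_combination a
    simpa [hne] using this
  exact congrFun (Continuous.ae_eq_iff_eq volume (by fun_prop) continuous_const |>.1 hae) ξ

/-! ### Plancherel and the lower Riesz bound -/

theorem l2_norm_sq_eq_integral (f : L2) : ‖f‖ ^ 2 = ∫ x, ‖f x‖ ^ 2 := by
  have h : ((‖f‖ ^ 2 : ℝ) : ℂ) = ((∫ x, ‖f x‖ ^ 2 : ℝ) : ℂ) := by
    have h1 := inner_self_eq_norm_sq_to_K (𝕜 := ℂ) f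
    rw [L2.inner_def] at h1
    simp_rw [inner_self_eq_norm_sq_to_K] at h1
    rw [← integral_complex_ofReal]
    push_cast
    exact h1.symm
  exact_mod_cast h

theorem coeFn_fourier_sum {φ : ℝ → ℂ} (h1 : MemLp φ 1 (volume : Measure ℝ))
    (h2 : MemLp φ 2 (volume : Measure ℝ)) (c : ℤ → ℂ) (s : Finset ℤ) :
    (𝓕 (∑ k ∈ s, c k • l2Translate (k : ℝ) (h2.toLp φ)) : L2) =ᵐ[volume]
      fun ξ => (∑ k ∈ s, c k * (𝐞 (-(k * ξ)) : ℂ)) * 𝓕 φ ξ := by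
  classical
  induction s using Finset.induction_on with
  | empty =>
    simp only [Finset.sum_empty, FourierTransform.fourier_zero, zero_mul]
    exact Lp.coeFn_zero ..
  | insert a s ha ih =>
    rw [Finset.sum_insert ha, FourierTransform.fourier_add, FourierTransform.fourier_smul]
    filter_upwards [ih, coeFn_fourier_l2Translate h1 h2 (a : ℝ),
      Lp.coeFn_add (c a • (𝓕 (l2Translate (a : ℝ) (h2.toLp φ)) : L2))
        (𝓕 (∑ k ∈ s, c k • l2Translate (k : ℝ) (h2.toLp φ)) : L2),
      Lp.coeFn_smul (c a) (𝓕 (l2Translate (a : ℝ) (h2.toLp φ)) : L2)] with ξ p q r t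
    rw [r, Pi.add_apply, t, Pi.smul_apply, p, q, Finset.sum_insert ha, smul_eq_mul]
    ring

theorem integrable_norm_sq_fourier_sum {φ : ℝ → ℂ} (h1 : MemLp φ 1 (volume : Measure ℝ))
    (h2 : MemLp φ 2 (volume : Measure ℝ)) (c : ℤ → ℂ) (s : Finset ℤ) :
    Integrable fun ξ => ‖(∑ k ∈ s, c k * (𝐞 (-(k * ξ)) : ℂ)) * 𝓕 φ ξ‖ ^ 2 := by
  have h := (memLp_congr_ae (coeFn_fourier_sum h1 h2 c s)).1 (Lp.memLp _)
  exact (memLp_two_iff_integrable_sq_norm h.1).1 h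

theorem norm_sq_sum_l2Translate {φ : ℝ → ℂ} (h1 : MemLp φ 1 (volume : Measure ℝ))
    (h2 : MemLp φ 2 (volume : Measure ℝ)) (c : ℤ → ℂ) (s : Finset ℤ) :
    ‖∑ k ∈ s, c k • l2Translate (k : ℝ) (h2.toLp φ)‖ ^ 2 =
      ∫ ξ, ‖(∑ k ∈ s, c k * (𝐞 (-(k * ξ)) : ℂ)) * 𝓕 φ ξ‖ ^ 2 := by
  rw [← Lp.norm_fourier_eq, l2_norm_sq_eq_integral]
  refine integral_congr_ae ?_
  filter_upwards [coeFn_fourier_sum h1 h2 c s] with ξ h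
  rw [h]

/-- The lower Riesz bound for finite sums. -/
theorem IsRieszGenerator.exists_lower_bound {φ : L2} (h : IsRieszGenerator φ) :
    ∃ A : ℝ, 0 < A ∧ ∀ (c : ℤ → ℂ) (s : Finset ℤ),
      A * ∑ k ∈ s, ‖c k‖ ^ 2 ≤ ‖∑ k ∈ s, c k • l2Translate (k : ℝ) φ‖ ^ 2 := by
  obtain ⟨A, B, hA, -, h⟩ := h
  refine ⟨A ^ 2, by positivity, fun c s => ?_⟩
  let d : ell2 := ∑ k ∈ s, lp.single 2 k (c k)
  have hd : ‖d‖ ^ 2 = ∑ k ∈ s, ‖c k‖ ^ 2 := by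
    have := lp.norm_sum_single (E := fun _ : ℤ => ℂ) (p := 2) (by norm_num) c s
    simpa using this
  have hdk : ∀ k, d k = if k ∈ s then c k else 0 := by
    intro k
    simp only [d, lp.coeFn_sum, Finset.sum_apply, lp.single_apply, Pi.single_apply]
    simp
  obtain ⟨f, hf, hAf, -⟩ := h d
  have hsum : HasSum (fun k : ℤ => d k • l2Translate (k : ℝ) φ)
      (∑ k ∈ s, d k • l2Translate (k : ℝ) φ) :=
    hasSum_sum_of_ne_finset_zero fun k hk => by simp [hdk, hk]
  have hfe : f = ∑ k ∈ s, c k • l2Translate (k : ℝ) φ := by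
    rw [hf.unique hsum]
    exact Finset.sum_congr rfl fun k hk => by rw [hdk, if_pos hk]
  rw [← hfe, ← hd, ← mul_pow]
  exact pow_le_pow_left₀ (by positivity) hAf 2

/-! ### Dirichlet kernel estimates -/

/-- The Dirichlet kernel `∑ₖ e^{-2πikx}`, `0 ≤ k < N`. -/
noncomputable def dirichlet (N : ℕ) (x : ℝ) : ℂ :=
  ∑ k ∈ Finset.range N, (𝐞 (-x) : ℂ) ^ k

theorem continuous_dirichlet (N : ℕ) : Continuous (dirichlet N) := by
  unfold dirichlet
  fun_prop

theorem dirichlet_add_int (N : ℕ) (x : ℝ) (n : ℤ) : dirichlet N (x + n) = dirichlet N x := by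
  have := fourierChar_neg_intCast_mul_add 1 x n
  simp only [Int.cast_one, one_mul] at this
  rw [dirichlet, this, dirichlet]

/-- Summing the geometric progression leaves a numerator of norm at most 2, so away from the
integers the kernel is bounded uniformly in `N`. -/
theorem norm_sq_dirichlet_mul_le (N : ℕ) (x : ℝ) :
    ‖dirichlet N x‖ ^ 2 * ‖1 - (𝐞 (-x) : ℂ)‖ ^ 2 ≤ 4 := by
  rw [← mul_pow, ← norm_mul, mul_comm, dirichlet, mul_neg_geom_sum]
  have : ‖1 - (𝐞 (-x) : ℂ) ^ N‖ ≤ 2 := (norm_sub_le _ _).trans (by rw [norm_one, norm_pow, Circle.norm_coe]; norm_num)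
  nlinarith [norm_nonneg (1 - (𝐞 (-x) : ℂ) ^ N)]

theorem integral_norm_sq_dirichlet (N : ℕ) : ∫ x in (0 : ℝ)..1, ‖dirichlet N x‖ ^ 2 = N := by
  have hcos : ∀ m : ℤ,
      ∫ x in (0 : ℝ)..1, Real.cos (2 * Real.pi * m * x) = if m = 0 then 1 else 0 := by
    intro m
    split_ifs with hm
    · simp [hm]
    · have hne : 2 * Real.pi * m ≠ 0 := by
        have : (m : ℝ) ≠ 0 := by exact_mod_cast hm
        positivity
      rw [intervalIntegral.integral_comp_mul_left (fun y => Real.cos y) hne, integral_cos]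
      have : Real.sin (2 * Real.pi * m * 1) = 0 :=
        Real.sin_eq_zero_iff.2 ⟨2 * m, by push_cast; ring⟩
      rw [this]; simp
  have hexp : ∀ x, ‖dirichlet N x‖ ^ 2 = ∑ k ∈ Finset.range N, ∑ l ∈ Finset.range N,
      Real.cos (2 * Real.pi * ((l : ℤ) - (k : ℤ) : ℤ) * x) := by
    intro x
    have h : ((‖dirichlet N x‖ ^ 2 : ℝ) : ℂ) = ∑ k ∈ Finset.range N, ∑ l ∈ Finset.range N,
        Complex.exp (((2 * Real.pi * ((l : ℤ) - (k : ℤ) : ℤ) * x : ℝ) : ℂ) * Complex.I) := by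
      push_cast
      rw [← Complex.mul_conj', dirichlet, map_sum, Finset.sum_mul_sum]
      refine Finset.sum_congr rfl fun k _ => Finset.sum_congr rfl fun l _ => ?_
      rw [map_pow, Real.fourierChar_apply, ← Complex.exp_conj, ← Complex.exp_nat_mul,
        ← Complex.exp_nat_mul, ← Complex.exp_add]
      congr 1
      simp [map_ofNat (starRingEnd ℂ) 2]
      ring
    have := congrArg Complex.re h
    rw [Complex.ofReal_re] at this
    rw [this]
    simp only [Complex.re_sum, Complex.exp_ofReal_mul_I_re]
  simp_rw [hexp]
  rw [intervalIntegral.integral_finsetSum fun k _ => Continuous.intervalIntegrable (by fun_prop) _ _]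
  have : ∀ k ∈ Finset.range N, ∫ x in (0 : ℝ)..1, ∑ l ∈ Finset.range N,
      Real.cos (2 * Real.pi * ((l : ℤ) - (k : ℤ) : ℤ) * x) = 1 := by
    intro k hk
    rw [intervalIntegral.integral_finsetSum
      fun k _ => Continuous.intervalIntegrable (by fun_prop) _ _]
    simp_rw [hcos, sub_eq_zero, Nat.cast_inj]
    simp [Finset.mem_range.1 hk]
  rw [Finset.sum_congr rfl this]
  simp

/-- The integral of `H` against `|dirichlet N|²` is at most `η N + O(1)` when the periodization of
`H` is continuous and vanishes at the integers. -/
theorem exists_integral_norm_sq_dirichlet_mul_le {H : ℝ → ℝ} (hH : Continuous H)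
    (hH0 : ∀ x, 0 ≤ H x) (hHz : ∀ n : ℤ, H n = 0) {u : ℤ → ℝ} (hu : Summable u)
    (hHu : ∀ n : ℤ, ∀ x ∈ Set.Icc (0 : ℝ) 1, H (x + n) ≤ u n) {η : ℝ} (hη : 0 < η) :
    ∃ C : ℝ, ∀ N : ℕ, Integrable (fun x => ‖dirichlet N x‖ ^ 2 * H x) →
      ∫ x, ‖dirichlet N x‖ ^ 2 * H x ≤ η * N + C := by
  set G : ℝ → ℝ := fun x => ∑' n : ℤ, H (x + n) with hG
  have hGc : ContinuousOn G (Set.Icc 0 1) := by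
    refine continuousOn_tsum (fun n => by fun_prop) hu fun n x hx => ?_
    rw [Real.norm_of_nonneg (hH0 _)]
    exact hHu n x hx
  have hle : ∀ x ∈ Set.Icc (0 : ℝ) 1, ∀ s : Finset ℤ, ∑ n ∈ s, H (x + n) ≤ G x := fun x hx s =>
    (Summable.of_nonneg_of_le (fun n => hH0 _) (fun n => hHu n x hx) hu).sum_le_tsum s
      fun _ _ => hH0 _
  have hG0 : G 0 = 0 := by simp [hG, hHz]
  have hG1 : G 1 = 0 := by
    have : ∀ n : ℤ, H (1 + n) = 0 := fun n => by simpa using hHz (1 + n)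
    simp [hG, this]
  have hne : ∀ x ∈ Set.Icc (0 : ℝ) 1, η ≤ G x → 1 - (𝐞 (-x) : ℂ) ≠ 0 := by
    intro x hx hGx h
    rw [sub_eq_zero, eq_comm, Real.fourierChar_apply, Complex.exp_eq_one_iff] at h
    obtain ⟨m, hm⟩ := h
    have hxm : x = ((-m : ℤ) : ℝ) := by
      have : (((-x : ℝ)) : ℂ) = (m : ℂ) := by
        have h2 : (2 * Real.pi * Complex.I : ℂ) ≠ 0 := Complex.two_pi_I_ne_zero
        apply mul_left_cancel₀ h2
        push_cast at hm ⊢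
        linear_combination hm
      have : -x = (m : ℝ) := by exact_mod_cast this
      push_cast; linarith
    have hm01 : -m = 0 ∨ -m = 1 := by
      have h0 : (0 : ℤ) ≤ -m := by have := hx.1; rw [hxm] at this; exact_mod_cast this
      have h1 : -m ≤ (1 : ℤ) := by have := hx.2; rw [hxm] at this; exact_mod_cast this
      omega
    rcases hm01 with h | h <;> rw [h] at hxm <;> norm_num at hxm <;> rw [hxm] at hGx <;> linarith
  -- Where `G < η` the constant suffices; the rest of `[0, 1]` is compact and avoids the endpoints,
  -- so there the weight is bounded below.
  obtain ⟨C, hC0, hC⟩ : ∃ C : ℝ, 0 ≤ C ∧ ∀ x ∈ Set.Icc (0 : ℝ) 1,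
      G x ≤ η + C * ‖1 - (𝐞 (-x) : ℂ)‖ ^ 2 := by
    have hK : IsCompact (Set.Icc (0 : ℝ) 1 ∩ G ⁻¹' Set.Ici η) :=
      isCompact_Icc.of_isClosed_subset (hGc.preimage_isClosed_of_isClosed isClosed_Icc isClosed_Ici)
        Set.inter_subset_left
    have hq : ContinuousOn (fun x => G x / ‖1 - (𝐞 (-x) : ℂ)‖ ^ 2)
        (Set.Icc (0 : ℝ) 1 ∩ G ⁻¹' Set.Ici η) := by
      refine (hGc.mono Set.inter_subset_left).div (by fun_prop) fun x hx => ?_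
      exact pow_ne_zero _ (norm_ne_zero_iff.2 (hne x hx.1 hx.2))
    obtain ⟨C, hC⟩ := hK.bddAbove_image hq
    refine ⟨max C 0, le_max_right _ _, fun x hx => ?_⟩
    have hp : 0 ≤ max C 0 * ‖1 - (𝐞 (-x) : ℂ)‖ ^ 2 := by positivity
    rcases le_or_gt η (G x) with h | h
    · have h1 := hC (Set.mem_image_of_mem _ ⟨hx, h⟩)
      have hpos : 0 < ‖1 - (𝐞 (-x) : ℂ)‖ ^ 2 := by
        have := norm_pos_iff.2 (hne x hx h)
        positivity
      have h2 := (div_le_iff₀ hpos).1 (h1.trans (le_max_left C 0))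
      linarith
    · linarith
  refine ⟨4 * C, fun N hint => ?_⟩
  have hDc := continuous_dirichlet N
  -- The integral over `ℝ` is a sum over unit intervals; bounding its finite partial sums avoids
  -- exchanging sum and integral.
  refine hasSum_le_of_sum_le hint.hasSum_intervalIntegral_comp_add_int fun s => ?_
  simp_rw [dirichlet_add_int]
  rw [← intervalIntegral.integral_finsetSum
    fun n _ => Continuous.intervalIntegrable (by fun_prop) _ _]
  calc ∫ x in (0 : ℝ)..1, ∑ n ∈ s, ‖dirichlet N x‖ ^ 2 * H (x + n)
      ≤ ∫ x in (0 : ℝ)..1, (η * ‖dirichlet N x‖ ^ 2 + 4 * C) := by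
        refine intervalIntegral.integral_mono_on zero_le_one
          (Continuous.intervalIntegrable (by fun_prop) _ _)
          (Continuous.intervalIntegrable (by fun_prop) _ _) fun x hx => ?_
        rw [← Finset.mul_sum]
        have h1 := (hle x hx s).trans (hC x hx)
        have h2 := mul_le_mul_of_nonneg_left h1 (sq_nonneg ‖dirichlet N x‖)
        have h3 := mul_le_mul_of_nonneg_left (norm_sq_dirichlet_mul_le N x) hC0
        linarith
    _ = η * N + 4 * C := by
        rw [intervalIntegral.integral_add (Continuous.intervalIntegrable (by fun_prop) _ _)
          (Continuous.intervalIntegrable (by fun_prop) _ _), intervalIntegral.integral_const_mul,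
          integral_norm_sq_dirichlet]
        simp

/-! ### Nonvanishing on cosets -/

/-- Under polynomial decay of order more than `1 / 2`, the Fourier transform of a Riesz generator
does not vanish identically on any coset of `ℤ`. -/
theorem exists_fourier_add_int_ne_zero {φ : ℝ → ℂ} (h1 : MemLp φ 1 (volume : Measure ℝ))
    (h2 : MemLp φ 2 (volume : Measure ℝ)) (hr : IsRieszGenerator (h2.toLp φ)) {ε C : ℝ}
    (hε : 0 < ε) (hC : ∀ ξ, ‖𝓕 φ ξ‖ * |ξ| ^ ((1 : ℝ) / 2 + ε) ≤ C) (ξ₀ : ℝ) :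
    ∃ j : ℤ, 𝓕 φ (ξ₀ + j) ≠ 0 := by
  by_contra! hz
  have hFc : Continuous (𝓕 φ) := continuous_fourier_of_memLp h1
  obtain ⟨A, hA, hlow⟩ := hr.exists_lower_bound
  let f : C(ℝ, ℝ) := ⟨fun ξ => ‖𝓕 φ ξ‖ ^ 2, by fun_prop⟩
  have hfO : f =O[Filter.cocompact ℝ] fun x : ℝ => |x| ^ (-(1 + 2 * ε)) := by
    refine Asymptotics.IsBigO.of_bound (C ^ 2) ?_
    filter_upwards [(Filter.hasBasis_cocompact.mem_of_mem (isCompact_singleton (x := (0 : ℝ))))]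
      with x hx
    have hx0 : 0 < |x| := abs_pos.2 hx
    have hsq : (|x| ^ ((1 : ℝ) / 2 + ε)) ^ 2 = |x| ^ (1 + 2 * ε) := by
      rw [← Real.rpow_natCast, ← Real.rpow_mul hx0.le]; congr 1; push_cast; ring
    rw [Real.norm_of_nonneg (show (0 : ℝ) ≤ f x from sq_nonneg _),
      Real.norm_of_nonneg (by positivity : (0 : ℝ) ≤ |x| ^ (-(1 + 2 * ε))),
      Real.rpow_neg hx0.le, ← div_eq_mul_inv, le_div_iff₀ (by positivity), ← hsq]
    change ‖𝓕 φ x‖ ^ 2 * _ ≤ _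
    rw [← mul_pow]
    exact pow_le_pow_left₀ (by positivity) (hC x) 2
  let K : TopologicalSpace.Compacts ℝ := ⟨Set.Icc ξ₀ (ξ₀ + 1), isCompact_Icc⟩
  -- Squaring the decay gives order `1 + 2ε > 1`, so suprema over unit intervals are summable.
  have hu : Summable fun n : ℤ => ‖(f.comp (ContinuousMap.addRight (n : ℝ))).restrict K‖ :=
    summable_of_isBigO (Real.summable_abs_int_rpow (by linarith : 1 < 1 + 2 * ε))
      ((isBigO_norm_restrict_cocompact f (by linarith) hfO K).comp_tendsto
        Int.tendsto_coe_cofinite)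
  obtain ⟨C', hC'⟩ := exists_integral_norm_sq_dirichlet_mul_le (H := fun x => ‖𝓕 φ (ξ₀ + x)‖ ^ 2)
    (by fun_prop) (fun x => by positivity) (fun n => by simp [hz n]) hu
    (fun n x hx => by
      have := ((f.comp (ContinuousMap.addRight (n : ℝ))).restrict K).norm_coe_le_norm
        ⟨ξ₀ + x, by constructor <;> linarith [hx.1, hx.2]⟩
      refine le_trans (le_of_eq ?_) this
      rw [ContinuousMap.restrict_apply, ContinuousMap.comp_apply, ContinuousMap.coe_addRight,
        Real.norm_of_nonneg (by exact sq_nonneg _)]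
      simp only [f, ContinuousMap.coe_mk, add_assoc])
    (half_pos hA)
  have hmain : ∀ N : ℕ, A * N ≤ A / 2 * N + C' := by
    intro N
    let s : Finset ℤ := (Finset.range N).map Nat.castEmbedding
    -- These coefficients recentre the kernel at `ξ₀`, where the periodization vanishes: the norm
    -- squared is at least `A N` but at most `(A/2) N + C'`.
    let c : ℤ → ℂ := fun k => (𝐞 (k * ξ₀) : ℂ)
    have hD : ∀ x, (∑ k ∈ s, c k * (𝐞 (-(k * (ξ₀ + x))) : ℂ)) = dirichlet N x := by
      intro x
      simp only [s, c, Finset.sum_map, Nat.castEmbedding_apply, Int.cast_natCast, dirichlet]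
      refine Finset.sum_congr rfl fun k _ => ?_
      rw [← Circle.coe_mul, ← AddChar.map_add_eq_mul, ← Circle.coe_pow, ← AddChar.map_nsmul_eq_pow]
      congr 2
      rw [nsmul_eq_mul]; ring
    have hI := (integrable_norm_sq_fourier_sum h1 h2 c s).comp_add_left ξ₀
    have hE := integral_add_left_eq_self (μ := (volume : Measure ℝ))
      (fun ξ => ‖(∑ k ∈ s, c k * (𝐞 (-(k * ξ)) : ℂ)) * 𝓕 φ ξ‖ ^ 2) ξ₀
    simp only [hD, norm_mul, mul_pow] at hI hE
    have h3 := hlow c s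
    rw [norm_sq_sum_l2Translate h1 h2] at h3
    simp only [norm_mul, mul_pow] at h3
    rw [← hE] at h3
    have h4 : ∑ k ∈ s, ‖c k‖ ^ 2 = N := by simp [c, s, Circle.norm_coe]
    rw [h4] at h3
    exact h3.trans (hC' N hI)
  obtain ⟨N, hN⟩ := exists_nat_gt (C' / (A / 2))
  rw [div_lt_iff₀ (by positivity)] at hN
  linarith [hmain N]

end ShiftInvariant

/-! ### Connectedness argument -/

theorem mainTheorem3 (n : ℕ) (hn : 2 ≤ n) (φ : ℝ → ℂ)
    (hφ1 : MemLp φ 1 (volume : Measure ℝ)) (hφ2 : MemLp φ 2 (volume : Measure ℝ))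
    (hriesz : ShiftInvariant.IsRieszGenerator (hφ2.toLp φ))
    (hinv : ShiftInvariant.IsInvInvariant n (ShiftInvariant.V2 (hφ2.toLp φ)))
    (ε : ℝ) (hε : 0 < ε) :
    (⨆ ξ : ℝ, ENNReal.ofReal (‖𝓕 φ ξ‖ * |ξ| ^ ((1 : ℝ) / 2 + ε))) = ⊤ := by
  by_contra htop
  obtain ⟨C, hC⟩ : ∃ C : ℝ, ∀ ξ, ‖𝓕 φ ξ‖ * |ξ| ^ ((1 : ℝ) / 2 + ε) ≤ C :=
    ⟨_, fun ξ => (ENNReal.ofReal_le_iff_le_toReal htop).1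
      (le_iSup (fun ξ : ℝ => ENNReal.ofReal (‖𝓕 φ ξ‖ * |ξ| ^ ((1 : ℝ) / 2 + ε))) ξ)⟩
  have hex := ShiftInvariant.exists_fourier_add_int_ne_zero hφ1 hφ2 hriesz hε hC
  have hFc : Continuous (𝓕 φ) := ShiftInvariant.continuous_fourier_of_memLp hφ1
  have hn0 : (n : ℝ) ≠ 0 := by positivity
  have hmem : ShiftInvariant.l2Translate ((1 : ℝ) / n) (hφ2.toLp φ) ∈
      ShiftInvariant.V2 (hφ2.toLp φ) := by
    -- The coefficient sequence `δ₀` shows that `φ` itself lies in `V2`.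
    have h := hinv 1 (hφ2.toLp φ) ⟨lp.single 2 0 1, ?_⟩
    · simpa using h
    · have h0 : ShiftInvariant.l2Translate 0 (hφ2.toLp φ) = hφ2.toLp φ := by
        refine Lp.ext ((ShiftInvariant.l2Translate_ae_eq 0 _).trans (.of_forall fun x => ?_))
        simp
      convert hasSum_single (0 : ℤ) ?_ using 1
      · simp [h0]
      · intro k hk
        simp [lp.single_apply, hk]
  have hzero : ∀ ξ : ℝ, ∀ j : ℤ, ¬ (n : ℤ) ∣ j → 𝓕 φ ξ * 𝓕 φ (ξ + j) = 0 := by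
    intro ξ j hj
    refine ShiftInvariant.fourier_mul_fourier_eq_zero hφ1 hφ2 hmem (fun h => hj ?_) ξ
    have h' := congrArg (fun z : Circle => (z : ℂ)) h
    simp only [Real.fourierChar_apply, Circle.coe_one, Complex.exp_eq_one_iff] at h'
    obtain ⟨m, hm⟩ := h'
    refine ⟨-m, ?_⟩
    have h2 : (2 * Real.pi * Complex.I : ℂ) ≠ 0 := Complex.two_pi_I_ne_zero
    have h3 : ((-(1 / n * j) : ℝ) : ℂ) = (m : ℂ) := by
      apply mul_left_cancel₀ h2
      push_cast at hm ⊢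
      linear_combination hm
    have h4 : (-(1 / n * j) : ℝ) = (m : ℝ) := by exact_mod_cast h3
    have h5 : (j : ℝ) = n * -m := by rw [← h4]; field_simp
    exact_mod_cast h5
  -- `U` collects the points of class `0` mod `n`, `W` all others.
  let U : Set ℝ := ⋃ j ∈ {j : ℤ | (n : ℤ) ∣ j}, {ξ | 𝓕 φ (ξ + j) ≠ 0}
  let W : Set ℝ := ⋃ j ∈ {j : ℤ | ¬ (n : ℤ) ∣ j}, {ξ | 𝓕 φ (ξ + j) ≠ 0}
  have hopen : ∀ j : ℤ, IsOpen {ξ : ℝ | 𝓕 φ (ξ + j) ≠ 0} := fun j =>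
    isOpen_ne_fun (by fun_prop) continuous_const
  have hU : IsOpen U := isOpen_biUnion fun j _ => hopen j
  have hW : IsOpen W := isOpen_biUnion fun j _ => hopen j
  have hdvd : ∀ ξ : ℝ, ∀ i j : ℤ, 𝓕 φ (ξ + i) ≠ 0 → 𝓕 φ (ξ + j) ≠ 0 → (n : ℤ) ∣ j - i := by
    intro ξ i j hi hj
    by_contra h
    have := hzero (ξ + i) (j - i) h
    have e : ξ + i + ((j - i : ℤ) : ℝ) = ξ + j := by push_cast; ring
    rw [e] at this
    exact (mul_ne_zero hi hj) this
  have hdisj : Disjoint U W := by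
    rw [Set.disjoint_left]
    intro ξ hξU hξW
    simp only [U, W, Set.mem_iUnion, Set.mem_ofPred_eq, exists_prop] at hξU hξW
    obtain ⟨i, hi, hi'⟩ := hξU
    obtain ⟨j, hj, hj'⟩ := hξW
    exact hj ((dvd_sub_left hi).1 (hdvd ξ i j hi' hj'))
  have hcover : Set.univ ⊆ U ∪ W := by
    intro ξ _
    obtain ⟨j, hj⟩ := hex ξ
    by_cases h : (n : ℤ) ∣ j
    · exact Or.inl (Set.mem_biUnion (show j ∈ {j : ℤ | (n : ℤ) ∣ j} from h) hj)
    · exact Or.inr (Set.mem_biUnion (show j ∈ {j : ℤ | ¬ (n : ℤ) ∣ j} from h) hj)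
  obtain ⟨j, hj⟩ := hex 0
  -- Translating by an index `j` that is nonvanishing at `0` moves the class to `0`.
  have hne : (Set.univ ∩ U).Nonempty :=
    ⟨0 + j, trivial, Set.mem_biUnion (show (0 : ℤ) ∈ {j : ℤ | (n : ℤ) ∣ j} from dvd_zero _)
      (by simpa using hj)⟩
  have huniv := isPreconnected_univ.subset_left_of_subset_union hU hW hdisj hcover hne
  have ha := huniv (Set.mem_univ (0 : ℝ))
  have hb := huniv (Set.mem_univ (1 : ℝ))
  simp only [U, Set.mem_iUnion, Set.mem_ofPred_eq, exists_prop] at ha hb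
  obtain ⟨i, hi, hi'⟩ := ha
  obtain ⟨k, hk, hk'⟩ := hb
  -- Index `k` at `1` is index `1 + k` at `0`, so classes `0` at both points force `n ∣ 1`.
  have hk'' : 𝓕 φ (0 + ((1 + k : ℤ) : ℝ)) ≠ 0 := by simpa using hk'
  have h1 := (dvd_sub_left hi).1 (hdvd 0 i (1 + k) hi' hk'')
  have h2 : (n : ℤ) ∣ 1 := (dvd_add_left hk).1 h1
  have := Int.le_of_dvd one_pos h2
  omega
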